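/- Let $M\ge 1$ and $m\ge 0$ be integers such that $\gcd(M,2m+2)=1$ if $m>0$. For $\tau,z_1,z_2,t\in\mathbb C$ with $\operatorname{Im}\tau>0$ and $z_1,z_2\notin\mathbb Z+\mathbb Z\tau$, write $q^x=e^{2\pi i\tau x}$ and let $$\Phi^{[m]}(\tau,z_1,z_2,t)=e^{2\pi i(m+1)t}\sum_{j\in\mathbb Z}\left(\frac{e^{2\pi ij(m+1)(z_1+z_2)}q^{j^2(m+1)}}{1-e^{2\pi iz_1}q^j}-\frac{e^{-2\pi ij(m+1)(z_1+z_2)}q^{j^2(m+1)}}{1-e^{-2\pi iz_2}q^j}\right)$$ (the numerator of the normalized supercharacter of the level-$m$ module $L(m\Lambda_0)$ over $\widehat{s\ell}_{2|1}$). For integers $n\ge1$ and $j$ let $$\Theta_{j,n}(\tau,z)=\sum_{x\in\mathbb Z+\frac{j}{2n}}q^{nx^2}e^{2\pi inxz},$$ $$R_{n;j}(\tau,v)=\sum_{\substack{l\in\mathbb Z\\ l\equiv j \bmod 2n}}\left(\operatorname{sign}\left(l+\tfrac12\right)-E\left(\left(l+2n\frac{\operatorname{Im}v}{\operatorname{Im}\tau}\right)\sqrt{\frac{\operatorname{Im}\tau}{n}}\right)\right)e^{-\frac{\pi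 il^2}{2n}\tau-2\pi ilv},\qquad E(x)=2\int_0^xe^{-\pi u^2}\,du .$$ Define the modified numerator $$\tilde\Phi^{[m]}(\tau,z_1,z_2,t)=\Phi^{[m]}(\tau,z_1,z_2,t)-\tfrac12e^{2\pi i(m+1)t}\sum_{j\in\mathbb Z/(2m+2)\mathbb Z}R_{m+1;j}\left(\tau,\tfrac{z_1-z_2}{2}\right)\bigl(\Theta_{j,m+1}-\Theta_{-j,m+1}\bigr)(\tau,z_1+z_2).$$ Then, for all such $\tau,z_1,z_2,t$: (a) $$\tilde\Phi^{[m]}\left(-\frac M\tau,\frac{z_1}\tau,\frac{z_2}\tau,t-\frac{z_1z_2}{\tau M}\right)=\frac\tau M\sum_{j,k\in\mathbb Z/M\mathbb Z}q^{\frac{(m+1)jk}{M}}e^{\frac{2\pi i(m+1)}{M}(kz_1+jz_2)}\tilde\Phi^{[m]}(M\tau,z_1+j\tau,z_2+k\tau,t);$$ (b) $$\tilde\Phi^{[m]}\left(\frac\tau M,\frac{z_1}M,\frac{z_2}M,t\right)=\sum_{j,k\in\mathbb Z/M\mathbb Z}q^{\frac{(m+1)jk}{M}}e^{\frac{2\pi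 i(m+1)}{M}(kz_1+jz_2)}\tilde\Phi^{[m]}(M\tau,z_1+j\tau,z_2+k\tau,t).$$ Here the sums over $\mathbb Z/M\mathbb Z$ are taken over arbitrary integer representatives of the pairs $(j,k)$; the value does not depend on the choice. -/

import Mathlib

open Complex

noncomputable section

namespace SL21

/-- `q ^ x = e^{2πi τ x}`, the convention for (possibly fractional) powers of `q = e^{2πiτ}`. -/
def qpow (τ x : ℂ) : ℂ := exp (2 * Real.pi * I * τ * x)

/-- The numerator `Φ^{[m]}(τ, z₁, z₂, t)` of the normalized supercharacter of the
`ŝl_{2|1}`-module `L(mΛ₀)`; the series converges absolutely for `Im τ > 0`, and its terms are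
defined when neither `z₁` nor `z₂` lies in `ℤ + ℤτ`. -/
def Phi (m : ℕ) (τ z₁ z₂ t : ℂ) : ℂ :=
  exp (2 * Real.pi * I * (m + 1) * t) *
    ∑' j : ℤ,
      (exp (2 * Real.pi * I * j * (m + 1) * (z₁ + z₂)) * qpow τ ((j : ℂ) ^ 2 * (m + 1)) /
          (1 - exp (2 * Real.pi * I * z₁) * qpow τ j) -
        exp (-(2 * Real.pi * I * j * (m + 1) * (z₁ + z₂))) * qpow τ ((j : ℂ) ^ 2 * (m + 1)) /
          (1 - exp (-(2 * Real.pi * I * z₂)) * qpow τ j))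

/-- The theta function `Θ_{j,k}(τ, z) = ∑_{x ∈ ℤ + j/(2k)} q^{k x²} e^{2πi k x z}` of degree
`k ≥ 1`. -/
def Theta (j : ℤ) (k : ℕ) (τ z : ℂ) : ℂ :=
  ∑' n : ℤ,
    qpow τ (k * ((n : ℂ) + j / (2 * k)) ^ 2) *
      exp (2 * Real.pi * I * k * ((n : ℂ) + j / (2 * k)) * z)

/-- `E(x) = 2 ∫₀ˣ e^{-πu²} du` on the real line. -/
def zwegersE (x : ℝ) : ℝ := 2 * ∫ u in (0 : ℝ)..x, Real.exp (-Real.pi * u ^ 2)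

/-- The term of index `n` of the series that defines `R_{m;j}(τ, v)`. -/
def zwegersRTerm (m : ℕ) (τ v : ℂ) (n : ℤ) : ℂ :=
  ((Real.sign ((n : ℝ) + 1 / 2) -
      zwegersE (((n : ℝ) + 2 * m * (v.im / τ.im)) * Real.sqrt (τ.im / m)) : ℝ) : ℂ) *
    exp (-(Real.pi * I * (n : ℂ) ^ 2 / (2 * m)) * τ - 2 * Real.pi * I * n * v)

/-- Zwegers' function `R_{m;j}(τ, v)`, for `m ≥ 1`: the sum over the integers
`n ≡ j mod 2m`, which are written as `n = j + 2mk` with `k ∈ ℤ`. -/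
def zwegersR (m : ℕ) (j : ℤ) (τ v : ℂ) : ℂ :=
  ∑' k : ℤ, zwegersRTerm m τ v (j + 2 * m * k)

/-- The correction `Φ^{[m]}_add`. Both `R_{m+1;j}` and `Θ_{j,m+1}` depend on `j` only
modulo `2m+2`, so the sum over `ℤ/(2m+2)ℤ` is taken over `0, …, 2m+1`. -/
def PhiAdd (m : ℕ) (τ z₁ z₂ t : ℂ) : ℂ :=
  -(1 / 2) * exp (2 * Real.pi * I * (m + 1) * t) *
    ∑ j ∈ Finset.range (2 * m + 2),
      zwegersR (m + 1) j τ ((z₁ - z₂) / 2) *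
        (Theta j (m + 1) τ (z₁ + z₂) - Theta (-(j : ℤ)) (m + 1) τ (z₁ + z₂))

/-- The modified numerator `Φ̃^{[m]} = Φ^{[m]} + Φ^{[m]}_add`. -/
def PhiTilde (m : ℕ) (τ z₁ z₂ t : ℂ) : ℂ :=
  Phi m τ z₁ z₂ t + PhiAdd m τ z₁ z₂ t

/-- The summand `q^{(m+1)jk/M} e^{2πi(m+1)(k z₁ + j z₂)/M} Φ̃^{[m]}(Mτ, z₁ + jτ, z₂ + kτ, t)`
attached to integers `j`, `k`. -/
def modSummand (M m : ℕ) (τ z₁ z₂ t : ℂ) (j k : ℤ) : ℂ :=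
  qpow τ ((m + 1) / M * j * k) * exp (2 * Real.pi * I * (m + 1) / M * (k * z₁ + j * z₂)) *
    PhiTilde m (M * τ) (z₁ + j * τ) (z₂ + k * τ) t

end SL21

end

/-!
Write `N = m + 1`. The modified numerator is `e^{2πiNt} (A(z₁, z₂) - A(-z₂, -z₁))`, where `A` is the
completed Appell–Lerch sum of degree `N`. The terms of `A` are grouped along the rows `z₁ + aτ + ℤ`
of the lattice. On each row, differentiating in the centre of the error functions and applying
Poisson summation converts `1 / (1 - e^{2πi(z₁ + aτ)})` plus its error-function correction into a
Gaussian series with the simple poles `1 / (z₁ + aτ + k)`. Hence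
`A(z₁, z₂) = Θ_{0,N}(z₁ + z₂) + (i / 2π) K(z₁, z₂)` with a Gaussian Kronecker–Eisenstein series `K`
over the full lattice, and the even theta function drops out of the antisymmetrization.

The inversion `τ ↦ -1/τ` merely permutes the lattice points of `K`, up to an elementary factor.
Summing the translates `(z₁ + jτ, z₂ + kτ)` over `Mτ` recovers, over `j`, all rows of the lattice
`ℤ + ℤτ`, while the sum over `k` is a character sum that, as `N` is prime to `M`, keeps exactly the
points with second coordinate divisible by `M`.
-/

noncomputable section

namespace SL21

open Filter MeasureTheory
open scoped Real

/-! ### The error function -/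

lemma hasDerivAt_zwegersE (x : ℝ) : HasDerivAt zwegersE (2 * Real.exp (-π * x ^ 2)) x := by
  have hc : Continuous fun u : ℝ => Real.exp (-π * u ^ 2) := by fun_prop
  exact (hc.integral_hasStrictDerivAt 0 x).hasDerivAt.const_mul 2

lemma zwegersE_neg (x : ℝ) : zwegersE (-x) = -zwegersE x := by
  have h := intervalIntegral.integral_comp_neg (a := 0) (b := x)
    (fun u : ℝ => Real.exp (-π * u ^ 2))
  simp only [neg_sq, neg_zero] at h
  rw [zwegersE, zwegersE, intervalIntegral.integral_symm, ← h, mul_neg]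

lemma one_sub_zwegersE (x : ℝ) :
    1 - zwegersE x = 2 * ∫ u in Set.Ioi x, Real.exp (-π * u ^ 2) := by
  have hint (a : ℝ) : IntegrableOn (fun u : ℝ => Real.exp (-π * u ^ 2)) (Set.Ioi a) :=
    (integrable_exp_neg_mul_sq Real.pi_pos).integrableOn
  have hsplit := intervalIntegral.integral_interval_add_Ioi (hint 0) (hint x)
  rw [integral_gaussian_Ioi, div_self Real.pi_ne_zero, Real.sqrt_one] at hsplit
  rw [zwegersE]
  linarith

lemma zwegersE_le_one (x : ℝ) : zwegersE x ≤ 1 := by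
  have h : 0 ≤ ∫ u in Set.Ioi x, Real.exp (-π * u ^ 2) :=
    integral_nonneg fun u => (Real.exp_pos _).le
  linarith [one_sub_zwegersE x]

lemma abs_zwegersE_le_one (x : ℝ) : |zwegersE x| ≤ 1 :=
  abs_le.2 ⟨by linarith [zwegersE_le_one (-x), zwegersE_neg x], zwegersE_le_one x⟩

lemma one_sub_zwegersE_le {x : ℝ} (hx : 0 ≤ x) : 1 - zwegersE x ≤ Real.exp (-π * x ^ 2) := by
  have hint : Integrable fun u : ℝ => Real.exp (-π * u ^ 2) :=
    integrable_exp_neg_mul_sq Real.pi_pos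
  have hshift : ∫ u in Set.Ioi x, Real.exp (-π * u ^ 2) =
      ∫ u in Set.Ioi 0, Real.exp (-π * (u + x) ^ 2) := by
    have h := (measurePreserving_add_right volume x).setIntegral_preimage_emb
      (measurableEmbedding_addRight x) (fun u : ℝ => Real.exp (-π * u ^ 2)) (Set.Ioi x)
    simpa using h.symm
  have hle : ∫ u in Set.Ioi 0, Real.exp (-π * (u + x) ^ 2) ≤
      ∫ u in Set.Ioi 0, Real.exp (-π * x ^ 2) * Real.exp (-π * u ^ 2) := by
    refine setIntegral_mono_on (hint.comp_add_right x).integrableOn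
      (hint.const_mul _).integrableOn measurableSet_Ioi fun u hu => ?_
    rw [← Real.exp_add, Real.exp_le_exp]
    nlinarith [mul_nonneg Real.pi_pos.le (mul_nonneg (Set.mem_Ioi.1 hu).le hx)]
  rw [integral_const_mul, integral_gaussian_Ioi, div_self Real.pi_ne_zero, Real.sqrt_one] at hle
  rw [one_sub_zwegersE, hshift]
  linarith

lemma abs_one_sub_zwegersE_add_le {x : ℝ} (hx : 0 ≤ x) (y : ℝ) :
    |1 - zwegersE (x + y)| ≤ 2 * Real.exp (-π * (x ^ 2 + 2 * x * y)) := by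
  rw [abs_of_nonneg (sub_nonneg.2 (zwegersE_le_one _))]
  rcases le_total 0 (x + y) with h | h
  · calc 1 - zwegersE (x + y) ≤ Real.exp (-π * (x + y) ^ 2) := one_sub_zwegersE_le h
      _ ≤ Real.exp (-π * (x ^ 2 + 2 * x * y)) := by
        rw [Real.exp_le_exp]
        nlinarith [mul_nonneg Real.pi_pos.le (sq_nonneg y)]
      _ ≤ _ := by linarith [Real.exp_pos (-π * (x ^ 2 + 2 * x * y))]
  · have hexp : 1 ≤ Real.exp (-π * (x ^ 2 + 2 * x * y)) := by
      rw [Real.one_le_exp_iff]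
      have : x ^ 2 + 2 * x * y ≤ 0 := by nlinarith
      nlinarith [Real.pi_pos]
    linarith [(abs_le.1 (abs_zwegersE_le_one (x + y))).1]

lemma sign_intCast_add_half (b : ℤ) :
    Real.sign ((b : ℝ) + 1 / 2) = if 0 ≤ b then 1 else -1 := by
  split_ifs with hb
  · have : (0 : ℝ) ≤ b := mod_cast hb
    exact Real.sign_of_pos (by linarith)
  · have : (b : ℝ) + 1 ≤ 0 := mod_cast not_le.1 hb
    exact Real.sign_of_neg (by linarith)

lemma abs_sign_sub_zwegersE_le {s : ℝ} (hs : 0 ≤ s) (c : ℝ) (b : ℤ) :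
    |Real.sign ((b : ℝ) + 1 / 2) - zwegersE ((b + c) * s)| ≤
      2 * Real.exp (-π * s ^ 2 * (b ^ 2 + 2 * b * c)) := by
  rw [sign_intCast_add_half]
  split_ifs with hb
  · have hbs : 0 ≤ b * s := mul_nonneg (mod_cast hb) hs
    convert abs_one_sub_zwegersE_add_le hbs (c * s) using 3 <;> ring_nf
  · have hb' : (b : ℝ) ≤ 0 := mod_cast (not_le.1 hb).le
    have hbs : 0 ≤ -b * s := mul_nonneg (neg_nonneg.2 hb') hs
    have h := abs_one_sub_zwegersE_add_le hbs (-c * s)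
    rw [show -b * s + -c * s = -((b + c) * s) by ring, zwegersE_neg, ← abs_neg] at h
    convert h using 3 <;> ring_nf

/-! ### Poisson summation along a row of the lattice -/

/-- The summand of the error-function series along a row of the lattice: `zwegersRTerm`, rescaled
by a theta summand, with scale `s` and centre `-c`. -/
def errTerm (s c : ℝ) (Z : ℂ) (b : ℤ) : ℂ :=
  ((Real.sign ((b : ℝ) + 1 / 2) - zwegersE ((b + c) * s) : ℝ) : ℂ) * exp (-(2 * π * I * b * Z))

/-- The Gaussian of width `s` and frequency `c`, sampled at the points `Z + k` of a row of the
lattice. -/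
def gaussTerm (s c : ℝ) (Z : ℂ) (k : ℤ) : ℂ :=
  exp (2 * π * I * (Z + k) * c - π * (Z + k) ^ 2 / s ^ 2)

/-- The Poisson-dual summand of `gaussTerm`. -/
def dualGaussTerm (s c : ℝ) (Z : ℂ) (b : ℤ) : ℂ :=
  s * exp (-π * ((b + c) * s) ^ 2 - 2 * π * I * b * Z)

lemma gaussTerm_eq (s c : ℝ) (Z : ℂ) (k : ℤ) :
    gaussTerm s c Z k = exp (2 * π * I * Z * c - π * Z ^ 2 / s ^ 2) *
      jacobiTheta₂_term k (c + I * Z / s ^ 2) (I / s ^ 2) := by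
  rw [jacobiTheta₂_term, gaussTerm, ← exp_add]
  congr 1
  linear_combination (-(π * k * (2 * Z + k) / s ^ 2) : ℂ) * I_sq

lemma dualGaussTerm_eq (s c : ℝ) (Z : ℂ) (b : ℤ) :
    dualGaussTerm s c Z b = s * exp (-π * s ^ 2 * c ^ 2) *
      jacobiTheta₂_term b (I * s ^ 2 * c - Z) (I * s ^ 2) := by
  rw [jacobiTheta₂_term, dualGaussTerm, mul_assoc (s : ℂ), ← exp_add]
  congr 2
  linear_combination (-(π * s ^ 2 * (2 * b * c + b ^ 2)) : ℂ) * I_sq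

lemma tsum_gaussTerm {s : ℝ} (hs : 0 < s) (c : ℝ) (Z : ℂ) :
    ∑' k, gaussTerm s c Z k = ∑' b, dualGaussTerm s c Z b := by
  have hs' : (s : ℂ) ≠ 0 := mod_cast hs.ne'
  have hroot : (-I * (I * s ^ 2) : ℂ) ^ (1 / 2 : ℂ) = s := by
    rw [show (-I * (I * s ^ 2) : ℂ) = (s : ℂ) ^ 2 by linear_combination (-(s : ℂ) ^ 2) * I_sq,
      one_div]
    exact sq_cpow_two_inv (by simpa using hs)
  have hpoint : (I * s ^ 2 * c - Z) / (I * s ^ 2) = c + I * Z / s ^ 2 := by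
    field_simp
    linear_combination (-Z) * I_sq
  have hmodulus : (-1 / (I * s ^ 2) : ℂ) = I / s ^ 2 := by
    field_simp
    linear_combination -I_sq
  have hexp : exp (2 * π * I * Z * c - π * Z ^ 2 / s ^ 2) =
      exp (-π * s ^ 2 * c ^ 2) * exp (-π * I * (I * s ^ 2 * c - Z) ^ 2 / (I * s ^ 2)) := by
    rw [← exp_add]
    congr 1
    field_simp
    linear_combination (s ^ 4 * c ^ 2 : ℂ) * I_sq
  simp only [gaussTerm_eq, dualGaussTerm_eq, tsum_mul_left]
  rw [← jacobiTheta₂, ← jacobiTheta₂, jacobiTheta₂_functional_equation (I * s ^ 2 * c - Z), hroot,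
    hpoint, hmodulus, hexp]
  field_simp

lemma norm_errTerm_le {s : ℝ} (hs : 0 ≤ s) (c : ℝ) (Z : ℂ) (b : ℤ) :
    ‖errTerm s c Z b‖ ≤ 2 * ‖jacobiTheta₂_term b (I * s ^ 2 * c - Z) (I * s ^ 2)‖ := by
  have him : (I * s ^ 2 * c - Z).im = s ^ 2 * c - Z.im ∧ (I * s ^ 2 : ℂ).im = s ^ 2 := by
    constructor <;> simp [← ofReal_pow]
  calc ‖errTerm s c Z b‖
      = |Real.sign ((b : ℝ) + 1 / 2) - zwegersE ((b + c) * s)| * Real.exp (2 * π * b * Z.im) := by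
        rw [errTerm, norm_mul, norm_real, Real.norm_eq_abs, norm_exp]
        simp
    _ ≤ 2 * Real.exp (-π * s ^ 2 * (b ^ 2 + 2 * b * c)) * Real.exp (2 * π * b * Z.im) := by
        gcongr
        exact abs_sign_sub_zwegersE_le hs c b
    _ = _ := by
        rw [norm_jacobiTheta₂_term, him.1, him.2, mul_assoc, ← Real.exp_add]
        ring_nf

lemma summable_errTerm {s : ℝ} (hs : 0 < s) (c : ℝ) (Z : ℂ) : Summable (errTerm s c Z) := by
  have him : 0 < (I * s ^ 2 : ℂ).im := by simpa [← ofReal_pow] using pow_pos hs 2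
  exact .of_norm_bounded (((summable_jacobiTheta₂_term_iff _ _).2 him).norm.mul_left 2)
    (norm_errTerm_le hs.le c Z)

lemma summable_gaussTerm {s : ℝ} (hs : 0 < s) (c : ℝ) (Z : ℂ) : Summable (gaussTerm s c Z) := by
  have him : 0 < (I / s ^ 2 : ℂ).im := by
    rw [← ofReal_pow, div_ofReal_im, I_im]
    positivity
  rw [funext (gaussTerm_eq s c Z)]
  exact ((summable_jacobiTheta₂_term_iff _ _).2 him).mul_left _

lemma summable_div_of_eventually_one_le_norm {ι 𝕜 : Type*} [NormedField 𝕜] [CompleteSpace 𝕜]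
    {f g : ι → 𝕜} (hf : Summable fun i => ‖f i‖) (hg : ∀ᶠ i in cofinite, 1 ≤ ‖g i‖) :
    Summable fun i => f i / g i := by
  refine .of_norm_bounded_eventually hf (hg.mono fun i hi => ?_)
  rw [norm_div]
  exact div_le_self (norm_nonneg _) hi

lemma eventually_one_le_norm_add_intCast (Z : ℂ) : ∀ᶠ k : ℤ in cofinite, 1 ≤ ‖Z + k‖ := by
  have h : Tendsto (fun k : ℤ => ‖(k : ℂ)‖) cofinite atTop := by
    simpa [Function.comp_def] using tendsto_norm_cocompact_atTop.comp Int.tendsto_coe_cofinite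
  filter_upwards [h.eventually_ge_atTop (1 + ‖Z‖)] with k hk
  have := norm_sub_norm_le (k : ℂ) (-Z)
  rw [sub_neg_eq_add, norm_neg, add_comm (k : ℂ)] at this
  linarith

lemma summable_gaussTerm_div {s : ℝ} (hs : 0 < s) (c : ℝ) (Z : ℂ) :
    Summable fun k : ℤ => gaussTerm s c Z k / (Z + k) :=
  summable_div_of_eventually_one_le_norm (summable_gaussTerm hs c Z).norm
    (eventually_one_le_norm_add_intCast Z)

lemma abs_lt_abs_add_one {c x : ℝ} (hx : x ∈ Metric.ball c 1) : |x| < |c| + 1 := by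
  have h : |x - c| < 1 := by simpa [Real.dist_eq] using hx
  linarith [abs_sub_abs_le_abs_sub x c]

lemma hasDerivAt_errTerm (s c : ℝ) (Z : ℂ) (b : ℤ) :
    HasDerivAt (fun x : ℝ => errTerm s x Z b) (-2 * dualGaussTerm s c Z b) c := by
  have hlin : HasDerivAt (fun x : ℝ => ((b : ℝ) + x) * s) s c := by
    simpa using ((hasDerivAt_id c).const_add (b : ℝ)).mul_const s
  have hE := ((hasDerivAt_zwegersE ((b + c) * s)).comp c hlin).const_sub
    (Real.sign ((b : ℝ) + 1 / 2))
  refine (hE.ofReal_comp.mul_const (exp (-(2 * π * I * b * Z)))).congr_deriv ?_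
  rw [dualGaussTerm, sub_eq_add_neg, exp_add]
  push_cast
  ring

lemma norm_dualGaussTerm_le {s x C : ℝ} (hs : 0 < s) (hx : |x| ≤ C) (Z : ℂ) (b : ℤ) :
    ‖dualGaussTerm s x Z b‖ ≤
      s * Real.exp (-π * (s ^ 2 * b ^ 2 - 2 * (s ^ 2 * C + |Z.im|) * |(b : ℝ)|)) := by
  have hexp : ‖exp (-π * s ^ 2 * x ^ 2)‖ ≤ 1 := by
    rw [show (-π * s ^ 2 * x ^ 2 : ℂ) = ((-(π * (s * x) ^ 2) : ℝ) : ℂ) by push_cast; ring,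
      norm_exp_ofReal, Real.exp_le_one_iff, neg_nonpos]
    positivity
  have him : |(I * s ^ 2 * x - Z).im| ≤ s ^ 2 * C + |Z.im| := by
    rw [show (I * s ^ 2 * x - Z).im = s ^ 2 * x - Z.im by simp [← ofReal_pow]]
    refine (abs_sub _ _).trans ?_
    rw [abs_mul, abs_of_pos (pow_pos hs 2)]
    gcongr
  have hterm := norm_jacobiTheta₂_term_le (pow_pos hs 2) him
    (show s ^ 2 ≤ (I * s ^ 2 : ℂ).im by simp [← ofReal_pow]) b
  rw [Int.cast_abs] at hterm
  rw [dualGaussTerm_eq, norm_mul, norm_mul, norm_real, Real.norm_of_nonneg hs.le, mul_assoc]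
  gcongr
  exact (mul_le_of_le_one_left (norm_nonneg _) hexp).trans hterm

lemma hasDerivAt_tsum_errTerm {s : ℝ} (hs : 0 < s) (c : ℝ) (Z : ℂ) :
    HasDerivAt (fun x : ℝ => ∑' b, errTerm s x Z b) (-2 * ∑' b, dualGaussTerm s c Z b) c := by
  have hc : c ∈ Metric.ball c 1 := Metric.mem_ball_self one_pos
  have hbound : Summable fun b : ℤ => 2 * (s * Real.exp (-π * (s ^ 2 * (b : ℝ) ^ 2 -
      2 * (s ^ 2 * (|c| + 1) + |Z.im|) * |(b : ℝ)|))) := by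
    simpa using ((summable_pow_mul_jacobiTheta₂_term_bound (s ^ 2 * (|c| + 1) + |Z.im|)
      (pow_pos hs 2) 0).mul_left s).mul_left 2
  rw [← tsum_mul_left]
  refine hasDerivAt_tsum_of_isPreconnected (g := fun b x => errTerm s x Z b) hbound
    Metric.isOpen_ball (convex_ball c 1).isPreconnected
    (fun b x _ => hasDerivAt_errTerm s x Z b) (fun b x hx => ?_) hc (summable_errTerm hs c Z) hc
  rw [norm_mul, norm_neg, RCLike.norm_ofNat]
  gcongr
  exact norm_dualGaussTerm_le hs (abs_lt_abs_add_one hx).le Z b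

lemma norm_gaussTerm (s c : ℝ) (Z : ℂ) (k : ℤ) :
    ‖gaussTerm s c Z k‖ = Real.exp (-2 * π * Z.im * c) * ‖gaussTerm s 0 Z k‖ := by
  have h : gaussTerm s c Z k = exp (2 * π * I * (Z + k) * c) * gaussTerm s 0 Z k := by
    rw [gaussTerm, gaussTerm, ← exp_add, ofReal_zero]
    ring_nf
  rw [h, norm_mul, norm_exp]
  simp

lemma hasDerivAt_gaussTerm_div (s c : ℝ) {Z : ℂ} {k : ℤ} (hZ : Z + k ≠ 0) :
    HasDerivAt (fun x : ℝ => gaussTerm s x Z k / (Z + k)) (2 * π * I * gaussTerm s c Z k) c := by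
  have h : HasDerivAt (fun x : ℝ => 2 * π * I * (Z + k) * (x : ℂ) - π * (Z + k) ^ 2 / s ^ 2)
      (2 * π * I * (Z + k)) c := by
    simpa using ((hasDerivAt_id c).ofReal_comp.const_mul (2 * π * I * (Z + k))).sub_const
      (π * (Z + k) ^ 2 / s ^ 2)
  refine (h.cexp.div_const (Z + k)).congr_deriv ?_
  rw [gaussTerm]
  field_simp

lemma hasDerivAt_tsum_gaussTerm_div {s : ℝ} (hs : 0 < s) (c : ℝ) {Z : ℂ}
    (hZ : ∀ k : ℤ, Z + k ≠ 0) :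
    HasDerivAt (fun x : ℝ => ∑' k : ℤ, gaussTerm s x Z k / (Z + k))
      (2 * π * I * ∑' k, gaussTerm s c Z k) c := by
  have hc : c ∈ Metric.ball c 1 := Metric.mem_ball_self one_pos
  rw [← tsum_mul_left]
  refine hasDerivAt_tsum_of_isPreconnected (g := fun (k : ℤ) x => gaussTerm s x Z k / (Z + k))
    ((summable_gaussTerm hs 0 Z).norm.mul_left
      (2 * π * Real.exp (2 * π * |Z.im| * (|c| + 1)))) Metric.isOpen_ball
    (convex_ball c 1).isPreconnected (fun k x _ => hasDerivAt_gaussTerm_div s x (hZ k))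
    (fun k x hx => ?_) hc (summable_gaussTerm_div hs c Z) hc
  have hexp : -2 * π * Z.im * x ≤ 2 * π * |Z.im| * (|c| + 1) := by
    calc -2 * π * Z.im * x = 2 * π * -(Z.im * x) := by ring
      _ ≤ 2 * π * (|Z.im| * |x|) := by
        rw [← abs_mul]
        gcongr
        exact neg_le_abs _
      _ ≤ 2 * π * (|Z.im| * (|c| + 1)) := by
        gcongr
        exact (abs_lt_abs_add_one hx).le
      _ = _ := by ring
  rw [norm_mul, norm_gaussTerm, show ‖(2 * π * I : ℂ)‖ = 2 * π by simp [abs_of_pos Real.pi_pos],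
    mul_assoc (2 * π)]
  gcongr

lemma tsum_errTerm_add_one {s : ℝ} (hs : 0 < s) (c : ℝ) (Z : ℂ) :
    ∑' b, errTerm s (c + 1) Z b = exp (2 * π * I * Z) * (∑' b, errTerm s c Z b - 2) := by
  have hjump (b : ℤ) : Real.sign (((b - 1 : ℤ) : ℝ) + 1 / 2) =
      Real.sign ((b : ℝ) + 1 / 2) - if b = 0 then 2 else 0 := by
    rw [sign_intCast_add_half, sign_intCast_add_half]
    rcases lt_trichotomy b 0 with hb | rfl | hb
    · rw [if_neg (by lia), if_neg (by lia), if_neg hb.ne, sub_zero]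
    · norm_num
    · rw [if_pos (by lia), if_pos hb.le, if_neg hb.ne', sub_zero]
  have hterm (b : ℤ) : errTerm s (c + 1) Z (b - 1) =
      exp (2 * π * I * Z) * (errTerm s c Z b - if b = 0 then 2 else 0) := by
    have hexp : exp (-(2 * π * I * ((b - 1 : ℤ) : ℂ) * Z)) =
        exp (2 * π * I * Z) * exp (-(2 * π * I * b * Z)) := by
      rw [← exp_add]
      push_cast
      ring_nf
    have harg : (((b - 1 : ℤ) : ℝ) + (c + 1)) * s = (b + c) * s := by
      push_cast
      ring
    rw [errTerm, errTerm, hjump, harg, hexp]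
    rcases eq_or_ne b 0 with rfl | hb
    · simp only [if_true, Int.cast_zero, mul_zero, zero_mul, neg_zero, exp_zero, ofReal_sub,
        ofReal_ofNat]
      ring
    · simp only [hb, if_false, sub_zero]
      ring
  rw [← (Equiv.subRight (1 : ℤ)).tsum_eq]
  simp only [Equiv.subRight_apply, hterm]
  rw [tsum_mul_left, (summable_errTerm hs c Z).tsum_sub (hasSum_ite_eq 0 2).summable,
    tsum_ite_eq]

lemma tsum_gaussTerm_div_add_one (s c : ℝ) (Z : ℂ) :
    ∑' k : ℤ, gaussTerm s (c + 1) Z k / (Z + k) =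
      exp (2 * π * I * Z) * ∑' k : ℤ, gaussTerm s c Z k / (Z + k) := by
  rw [← tsum_mul_left]
  refine tsum_congr fun k => ?_
  have h : gaussTerm s (c + 1) Z k = gaussTerm s c Z k * exp (2 * π * I * (Z + k)) := by
    rw [gaussTerm, gaussTerm, ← exp_add, ofReal_add, ofReal_one]
    ring_nf
  rw [h, mul_add, exp_add, mul_comm (2 * π * I : ℂ) k, exp_int_mul_two_pi_mul_I]
  ring

lemma exp_two_pi_mul_I_mul_ne_one {Z : ℂ} (hZ : ∀ k : ℤ, Z + k ≠ 0) :
    exp (2 * π * I * Z) ≠ 1 := by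
  intro h
  obtain ⟨n, hn⟩ := exp_eq_one_iff.1 h
  refine hZ (-n) ?_
  rw [mul_comm (n : ℂ)] at hn
  rw [mul_left_cancel₀ two_pi_I_ne_zero hn]
  simp

/-- The two series have opposite derivatives in `c` by Poisson summation, and the translation
`c ↦ c + 1` then determines the constant. -/
theorem inv_one_sub_exp_add_tsum_errTerm {s : ℝ} (hs : 0 < s) (c : ℝ) {Z : ℂ}
    (hZ : ∀ k : ℤ, Z + k ≠ 0) :
    (1 - exp (2 * π * I * Z))⁻¹ + 1 / 2 * ∑' b, errTerm s c Z b =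
      1 + I / (2 * π) * ∑' k : ℤ, gaussTerm s c Z k / (Z + k) := by
  set D : ℝ → ℂ := fun x =>
    1 / 2 * ∑' b, errTerm s x Z b - I / (2 * π) * ∑' k : ℤ, gaussTerm s x Z k / (Z + k) with hD
  have hderiv (x : ℝ) : HasDerivAt D 0 x := by
    refine (((hasDerivAt_tsum_errTerm hs x Z).const_mul _).sub
      ((hasDerivAt_tsum_gaussTerm_div hs x hZ).const_mul _)).congr_deriv ?_
    rw [tsum_gaussTerm hs]
    field_simp
    linear_combination (-∑' b, dualGaussTerm s x Z b) * I_sq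
  have hconst : D (c + 1) = D c :=
    is_const_of_deriv_eq_zero (fun x => (hderiv x).differentiableAt) (fun x => (hderiv x).deriv) _ _
  have hshift : D (c + 1) = exp (2 * π * I * Z) * (D c - 1) := by
    simp only [hD, tsum_errTerm_add_one hs, tsum_gaussTerm_div_add_one]
    ring
  have hne : 1 - exp (2 * π * I * Z) ≠ 0 := sub_ne_zero.2 (exp_two_pi_mul_I_mul_ne_one hZ).symm
  have hDc : D c = 1 - (1 - exp (2 * π * I * Z))⁻¹ := by
    field_simp
    linear_combination hshift - hconst
  linear_combination hDc

/-! ### Sums over residue classes -/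

section Residue

variable {n : ℕ} [NeZero n]

lemma tsum_int_eq_sum_range {E : Type*} [AddCommGroup E] [UniformSpace E] [IsUniformAddGroup E]
    [CompleteSpace E] [T0Space E] {f : ℤ → E} (hf : Summable f) :
    ∑' l, f l = ∑ j ∈ Finset.range n, ∑' k : ℤ, f (j + n * k) := by
  set e : Fin n × ℤ ≃ ℤ := (Equiv.prodComm (Fin n) ℤ).trans (Int.divModEquiv n).symm with he
  have hs : Summable fun p : Fin n × ℤ => f (e p) := (Equiv.summable_iff e).2 hf
  rw [← e.tsum_eq f, hs.tsum_prod, tsum_fintype, Finset.sum_range]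
  refine Finset.sum_congr rfl fun j _ => tsum_congr fun k => congrArg f ?_
  simp only [he, Equiv.trans_apply, Equiv.prodComm_apply, Prod.swap_prod_mk, Int.divModEquiv,
    Equiv.coe_fn_symm_mk]
  ring

variable {R : Type*} [NormedRing R] [CompleteSpace R] {f : ℤ → R} {g : ℤ → ℤ → R}

/-- The row sums of `‖g‖` are periodic, hence bounded. -/
lemma summable_mul_of_shift (hf : Summable fun l => ‖f l‖) (hg : ∀ l, Summable fun a => ‖g l a‖)
    (hshift : ∀ l a, g (l + n) a = g l (a - 1)) :
    Summable fun p : ℤ × ℤ => f p.1 * g p.1 p.2 := by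
  have hper : Function.Periodic (fun l => ∑' a, ‖g l a‖) (n : ℤ) := fun l => by
    simp only [hshift]
    exact (Equiv.subRight (1 : ℤ)).tsum_eq fun a => ‖g l a‖
  obtain ⟨C, hC⟩ : BddAbove (Set.range fun l => ∑' a, ‖g l a‖) := by
    rw [← hper.image_Ioc (mod_cast NeZero.pos n) 0]
    exact ((Set.finite_Ioc _ _).image _).bddAbove
  have hrows : Summable fun l => ‖f l‖ * ∑' a, ‖g l a‖ := by
    refine .of_nonneg_of_le (fun l => ?_) (fun l => ?_) (hf.mul_right C)
    · exact mul_nonneg (norm_nonneg _) (tsum_nonneg fun a => norm_nonneg _)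
    · exact mul_le_mul_of_nonneg_left (hC ⟨l, rfl⟩) (norm_nonneg _)
  have hprod : Summable fun p : ℤ × ℤ => ‖f p.1‖ * ‖g p.1 p.2‖ := by
    refine (summable_prod_of_nonneg (f := fun p : ℤ × ℤ => ‖f p.1‖ * ‖g p.1 p.2‖)
      fun p => by positivity).2 ⟨fun l => (hg l).mul_left ‖f l‖, ?_⟩
    simpa only [tsum_mul_left] using hrows
  exact .of_norm_bounded hprod fun p => norm_mul_le _ _

lemma sum_range_tsum_mul_tsum (hf : Summable fun l => ‖f l‖) (hg : ∀ l, Summable fun a => ‖g l a‖)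
    (hshift : ∀ l a, g (l + n) a = g l (a - 1)) :
    ∑ j ∈ Finset.range n, (∑' k : ℤ, f (j + n * k)) * ∑' a, g j a =
      ∑' a, ∑' l, f l * g l a := by
  have hs := summable_mul_of_shift hf hg hshift
  have hper : Function.Periodic (fun l => ∑' a, g l a) (n : ℤ) := fun l => by
    simp only [hshift]
    exact (Equiv.subRight (1 : ℤ)).tsum_eq (g l)
  rw [Summable.tsum_comm (f := fun l a => f l * g l a) hs, tsum_int_eq_sum_range (n := n) hs.prod]
  refine Finset.sum_congr rfl fun j _ => ?_
  have hfj : Summable fun k : ℤ => f (j + n * k) := hf.of_norm.comp_injective fun k l h =>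
    mul_left_cancel₀ (mod_cast NeZero.ne n) (add_left_cancel h)
  rw [← hfj.tsum_mul_right]
  refine tsum_congr fun k => ?_
  calc f (j + n * k) * ∑' a, g j a = f (j + n * k) * ∑' a, g (j + k * n) a :=
        congrArg _ (hper.int_mul k j).symm
    _ = ∑' a, f (j + n * k) * g (j + n * k) a := by
        rw [mul_comm k, (hg _).of_norm.tsum_mul_left]

end Residue

/-! ### The terms of the theta functions and of `R` -/

section Terms

variable {N : ℕ} {τ : ℂ}

/-- The term of index `a` of the series that defines `Theta j N τ u`. -/
def thetaTerm (N : ℕ) (τ u : ℂ) (j a : ℤ) : ℂ :=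
  qpow τ (N * ((a : ℂ) + j / (2 * N)) ^ 2) * exp (2 * π * I * N * ((a : ℂ) + j / (2 * N)) * u)

lemma summable_thetaTerm (hN : N ≠ 0) (hτ : 0 < τ.im) (u : ℂ) (j : ℤ) :
    Summable (thetaTerm N τ u j) := by
  have hN' : (N : ℂ) ≠ 0 := mod_cast hN
  have him : 0 < (2 * N * τ : ℂ).im := by
    rw [show (2 * N * τ : ℂ).im = 2 * N * τ.im by simp]
    positivity
  have h := ((summable_jacobiTheta₂_term_iff (j * τ + N * u) (2 * N * τ)).2 him).mul_left
    (exp (2 * π * I * (τ * j ^ 2 / (4 * N) + j * u / 2)))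
  refine h.congr fun a => ?_
  rw [thetaTerm, qpow, jacobiTheta₂_term, ← exp_add, ← exp_add]
  congr 1
  field_simp
  ring

lemma thetaTerm_neg_add (hN : N ≠ 0) (τ u : ℂ) (l a : ℤ) :
    thetaTerm N τ u (-(l + (2 * N : ℕ))) a = thetaTerm N τ u (-l) (a - 1) := by
  have hN' : (N : ℂ) ≠ 0 := mod_cast hN
  have h : (a : ℂ) + ((-(l + (2 * N : ℕ)) : ℤ) : ℂ) / (2 * N) =
      ((a - 1 : ℤ) : ℂ) + ((-l : ℤ) : ℂ) / (2 * N) := by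
    push_cast
    field_simp
    ring
  rw [thetaTerm, thetaTerm, h]

lemma Theta_neg_neg (j : ℤ) (N : ℕ) (τ u : ℂ) : Theta (-j) N τ (-u) = Theta j N τ u := by
  rw [Theta, Theta, ← (Equiv.neg ℤ).tsum_eq]
  refine tsum_congr fun a => ?_
  simp only [Equiv.neg_apply]
  push_cast
  ring_nf

lemma sq_sqrt_im_div (N : ℕ) (hτ : 0 ≤ τ.im) : ((√(τ.im / N) : ℝ) : ℂ) ^ 2 = τ.im / N := by
  rw [← ofReal_pow, Real.sq_sqrt (by positivity), ofReal_div, ofReal_natCast]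

lemma zwegersRTerm_eq (N : ℕ) (τ v : ℂ) (l : ℤ) :
    zwegersRTerm N τ v l = exp (-(π * I * l ^ 2 / (2 * N) * τ)) *
      errTerm √(τ.im / N) (2 * N * (v.im / τ.im)) v l := by
  rw [zwegersRTerm, errTerm, mul_left_comm, ← exp_add]
  ring_nf

lemma summable_zwegersRTerm (hN : N ≠ 0) (hτ : 0 < τ.im) (v : ℂ) :
    Summable (zwegersRTerm N τ v) := by
  have := Nat.pos_of_ne_zero hN
  have him : (τ / (2 * N)).im = τ.im / (2 * N) := by
    rw [← ofReal_natCast, ← ofReal_ofNat, ← ofReal_mul, div_ofReal_im]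
  have him_pos : 0 < (τ / (2 * N)).im := by
    rw [him]
    positivity
  refine .of_norm_bounded (((summable_jacobiTheta₂_term_iff v _).2 him_pos).norm.mul_left 2)
    fun l => ?_
  have herr := norm_errTerm_le (Real.sqrt_nonneg (τ.im / N)) (2 * N * (v.im / τ.im)) v l
  rw [sq_sqrt_im_div N hτ.le] at herr
  have hexp : ‖exp (-(π * I * l ^ 2 / (2 * N) * τ))‖ = Real.exp (π * l ^ 2 * (τ.im / (2 * N))) := by
    rw [norm_exp, ← him]
    congr 1
    rw [show (-(π * I * l ^ 2 / (2 * N) * τ) : ℂ) =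
      ((π * l ^ 2 : ℝ) : ℂ) * -(I * (τ / (2 * N))) by push_cast; ring, re_ofReal_mul, neg_re,
      I_mul_re, neg_neg]
  rw [zwegersRTerm_eq, norm_mul, hexp]
  refine (mul_le_mul_of_nonneg_left herr (Real.exp_pos _).le).trans_eq ?_
  have h1 : (I * (τ.im / N) : ℂ).im = τ.im / N := by
    simp [← ofReal_natCast, ← ofReal_div]
  have h2 : (I * (τ.im / N) * ((2 * N * (v.im / τ.im) : ℝ) : ℂ) - v).im = v.im := by
    rw [← ofReal_natCast, ← ofReal_div, sub_im, mul_assoc, ← ofReal_mul, I_mul_im, ofReal_re]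
    field_simp
    ring
  rw [norm_jacobiTheta₂_term, norm_jacobiTheta₂_term, h1, h2, him, mul_left_comm, ← Real.exp_add]
  field_simp
  ring_nf

/-- Completing the square in the row index: all rows share the same error-function series up to
the shift of its argument by `aτ`. -/
lemma zwegersRTerm_mul_thetaTerm (hN : N ≠ 0) (τ u v : ℂ) (l a : ℤ) :
    zwegersRTerm N τ v l * thetaTerm N τ u (-l) a = thetaTerm N τ u 0 a *
      errTerm √(τ.im / N) (2 * N * (v.im / τ.im)) (u / 2 + v + a * τ) l := by
  have hN' : (N : ℂ) ≠ 0 := mod_cast hN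
  rw [zwegersRTerm, errTerm, mul_assoc, mul_left_comm (thetaTerm N τ u 0 a)]
  congr 1
  rw [thetaTerm, thetaTerm, qpow, qpow, ← exp_add, ← exp_add, ← exp_add, ← exp_add]
  congr 1
  push_cast
  field_simp
  ring

lemma hasSum_zwegersR_mul_Theta (hN : N ≠ 0) (hτ : 0 < τ.im) (u v : ℂ) :
    HasSum (fun a : ℤ => thetaTerm N τ u 0 a *
        ∑' l, errTerm √(τ.im / N) (2 * N * (v.im / τ.im)) (u / 2 + v + a * τ) l)
      (∑ j ∈ Finset.range (2 * N), zwegersR N j τ v * Theta (-(j : ℤ)) N τ u) := by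
  have : NeZero (2 * N) := ⟨by positivity⟩
  have hR := (summable_zwegersRTerm hN hτ v).norm
  have hΘ (l : ℤ) := (summable_thetaTerm hN hτ u (-l)).norm
  have hprod := summable_mul_of_shift (n := 2 * N) hR hΘ (thetaTerm_neg_add hN τ u)
  have hsum := hprod.prod_symm.prod.hasSum
  have hresidue := sum_range_tsum_mul_tsum (n := 2 * N) hR hΘ (thetaTerm_neg_add hN τ u)
  simp only [Prod.fst_swap, Prod.snd_swap] at hsum
  rw [← hresidue] at hsum
  simp only [zwegersRTerm_mul_thetaTerm hN, tsum_mul_left] at hsum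
  simpa [zwegersR, Theta, thetaTerm] using hsum

end Terms

/-! ### The Gaussian Kronecker–Eisenstein series -/

section Lattice

variable {N : ℝ} {τ : ℂ}

/-- The term of `latticeSum N τ w z` at the lattice point `p.1 * τ + p.2`. -/
def latticeTerm (N : ℝ) (τ w z : ℂ) (p : ℤ × ℤ) : ℂ :=
  exp (-(π * N / τ.im * ‖z + p.1 * τ + p.2‖ ^ 2 : ℝ) +
      2 * π * I * (p.1 * w - (z + p.1 * τ + p.2) * (w.im / τ.im))) /
    (z + p.1 * τ + p.2)

/-- The Gaussian Kronecker–Eisenstein series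
`∑ e^{-πN|z+ω|²/Im τ} e^{2πi(aw - (z+ω) Im w / Im τ)} / (z + ω)` over `ω = aτ + k`. -/
def latticeSum (N : ℝ) (τ w z : ℂ) : ℂ := ∑' p : ℤ × ℤ, latticeTerm N τ w z p

/-- The point `z` is not congruent to `0` modulo the lattice `ℤ + ℤτ`. -/
def OffLattice (τ z : ℂ) : Prop := ∀ a b : ℤ, z ≠ a + b * τ

lemma OffLattice.add_ne_zero {z : ℂ} (hz : OffLattice τ z) (a b : ℤ) : z + a * τ + b ≠ 0 :=
  fun h => hz (-b) (-a) <| by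
    push_cast
    linear_combination h

lemma exists_norm_lattice_lower_bound (hτ : 0 < τ.im) (z : ℂ) :
    ∃ β : ℝ, 0 < β ∧ ∀ a k : ℤ,
      β * ((a : ℝ) ^ 2 + (k : ℝ) ^ 2) - ‖z‖ ^ 2 ≤ ‖z + a * τ + k‖ ^ 2 := by
  set r := EisensteinSeries.r ⟨τ, hτ⟩
  have hr_pos : 0 < r := EisensteinSeries.r_pos _
  refine ⟨r ^ 2 / 4, by positivity, fun a k => ?_⟩
  have hlattice : r * ‖![a, k]‖ ≤ ‖(a : ℂ) * τ + k‖ := by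
    by_cases h : ![a, k] = 0
    · rw [h, norm_zero, mul_zero]
      exact norm_nonneg _
    · simpa using EisensteinSeries.r_mul_max_le ⟨τ, hτ⟩ h
  have htriangle : ‖(a : ℂ) * τ + k‖ ≤ ‖z + a * τ + k‖ + ‖z‖ := by
    have := norm_sub_le (z + a * τ + k) z
    rwa [show z + a * τ + k - z = (a : ℂ) * τ + k by ring] at this
  have ha : (a : ℝ) ^ 2 ≤ ‖![a, k]‖ ^ 2 :=
    sq_le_sq' (abs_le.1 (norm_le_pi_norm ![a, k] 0)).1 (abs_le.1 (norm_le_pi_norm ![a, k] 0)).2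
  have hk : (k : ℝ) ^ 2 ≤ ‖![a, k]‖ ^ 2 :=
    sq_le_sq' (abs_le.1 (norm_le_pi_norm ![a, k] 1)).1 (abs_le.1 (norm_le_pi_norm ![a, k] 1)).2
  have hsq : (r * ‖![a, k]‖) ^ 2 ≤ (‖z + a * τ + k‖ + ‖z‖) ^ 2 :=
    pow_le_pow_left₀ (by positivity) (hlattice.trans htriangle) 2
  have hcoord := mul_le_mul_of_nonneg_left (add_le_add ha hk) (sq_nonneg r)
  nlinarith [sq_nonneg (‖z + a * τ + k‖ - ‖z‖)]

lemma summable_exp_neg_norm_lattice (hτ : 0 < τ.im) (z : ℂ) {α : ℝ} (hα : 0 < α) :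
    Summable fun p : ℤ × ℤ => Real.exp (-(α * ‖z + p.1 * τ + p.2‖ ^ 2)) := by
  obtain ⟨β, hβ, hb⟩ := exists_norm_lattice_lower_bound hτ z
  have hgauss : Summable fun n : ℤ => Real.exp (-(α * β * (n : ℝ) ^ 2)) := by
    refine (summable_pow_mul_jacobiTheta₂_term_bound 0 (T := α * β / π) (by positivity) 0).congr
      fun n => ?_
    rw [pow_zero, one_mul]
    congr 1
    field_simp
    ring
  refine .of_nonneg_of_le (fun _ => (Real.exp_pos _).le) (fun p => ?_)
    ((hgauss.mul_of_nonneg hgauss (fun _ => (Real.exp_pos _).le)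
      fun _ => (Real.exp_pos _).le).mul_left (Real.exp (α * ‖z‖ ^ 2)))
  rw [← Real.exp_add, ← Real.exp_add]
  refine Real.exp_le_exp.2 ?_
  have := mul_le_mul_of_nonneg_left (hb p.1 p.2) hα.le
  linarith

lemma eventually_one_le_norm_lattice (hτ : 0 < τ.im) (z : ℂ) :
    ∀ᶠ p : ℤ × ℤ in cofinite, 1 ≤ ‖z + p.1 * τ + p.2‖ := by
  have h := (summable_exp_neg_norm_lattice hτ z one_pos).tendsto_cofinite_zero
  filter_upwards [h.eventually_lt_const (Real.exp_pos (-1))] with p hp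
  have hsq := Real.exp_lt_exp.1 hp
  rw [one_mul, neg_lt_neg_iff] at hsq
  exact (one_lt_sq_iff₀ (norm_nonneg _)).1 hsq |>.le

lemma summable_latticeTerm (hN : 0 < N) (hτ : 0 < τ.im) (w z : ℂ) :
    Summable (latticeTerm N τ w z) := by
  refine summable_div_of_eventually_one_le_norm ?_ (eventually_one_le_norm_lattice hτ z)
  refine ((summable_exp_neg_norm_lattice hτ z (by positivity : 0 < π * N / τ.im)).mul_right
    (Real.exp (2 * π * (z.im * w.im / τ.im)))).congr fun p => ?_
  rw [norm_exp, ← Real.exp_add]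
  congr 1
  have hphase : (2 * π * I * (p.1 * w - (z + p.1 * τ + p.2) * (w.im / τ.im)) : ℂ) =
      ((2 * π : ℝ) : ℂ) * (I * (((p.1 : ℝ) : ℂ) * w -
        ((w.im / τ.im : ℝ) : ℂ) * (z + ((p.1 : ℝ) : ℂ) * τ + ((p.2 : ℝ) : ℂ)))) := by
    push_cast
    ring
  rw [hphase, add_re, neg_re, ofReal_re, re_ofReal_mul, I_mul_re, sub_im, im_ofReal_mul,
    im_ofReal_mul, add_im, add_im, im_ofReal_mul, ofReal_im]
  field_simp
  ring

lemma latticeSum_neg_neg (N : ℝ) (τ w z : ℂ) :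
    latticeSum N τ (-w) (-z) = -latticeSum N τ w z := by
  rw [latticeSum, latticeSum, ← tsum_neg, ← (Equiv.neg (ℤ × ℤ)).tsum_eq]
  refine tsum_congr fun p => ?_
  have hpoint : -z + ((-p).1 : ℂ) * τ + ((-p).2 : ℂ) = -(z + p.1 * τ + p.2) := by
    simp only [Prod.fst_neg, Prod.snd_neg]
    push_cast
    ring
  rw [Equiv.neg_apply, latticeTerm, latticeTerm, hpoint, norm_neg, div_neg, neg_im]
  congr 4
  simp only [Prod.fst_neg]
  push_cast
  ring

lemma neg_one_div_im (τ : ℂ) : (-1 / τ).im = τ.im / normSq τ := by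
  rw [neg_div, one_div, neg_im, inv_im, neg_div, neg_neg]

lemma div_im_div_neg_one_div_im (hτ : τ.im ≠ 0) (w : ℂ) :
    ((w / τ).im / (-1 / τ).im : ℂ) = τ * (w.im / τ.im) - w := by
  have hτ_ne : τ ≠ 0 := fun h => hτ (by rw [h, zero_im])
  have hnormSq : normSq τ ≠ 0 := (normSq_pos.2 hτ_ne).ne'
  have hreal : (w / τ).im / (-1 / τ).im = τ.re * (w.im / τ.im) - w.re := by
    rw [div_im, neg_one_div_im]
    field_simp
  rw [← ofReal_div, hreal]
  apply Complex.ext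
  · simp [← ofReal_div]
  · simp [← ofReal_div, mul_div_cancel₀ _ hτ]

lemma latticeTerm_neg_one_div (N : ℝ) (hτ : τ.im ≠ 0) (w z : ℂ) (a k : ℤ) :
    latticeTerm N (-1 / τ) (w / τ) (z / τ) (a, k) =
      τ * exp (2 * π * I * (w * z / τ)) * latticeTerm N τ w z (k, -a) := by
  have hτ_ne : τ ≠ 0 := fun h => hτ (by rw [h, zero_im])
  have hnormSq : normSq τ ≠ 0 := (normSq_pos.2 hτ_ne).ne'
  have hpoint : z / τ + a * (-1 / τ) + k = (z + k * τ + (-a : ℤ)) / τ := by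
    push_cast
    field_simp
    ring
  have hgauss (Z : ℂ) : π * N / (-1 / τ).im * ‖Z / τ‖ ^ 2 = π * N / τ.im * ‖Z‖ ^ 2 := by
    rw [neg_one_div_im, norm_div, div_pow, ← normSq_eq_norm_sq τ]
    field_simp
  rw [latticeTerm, latticeTerm, hpoint, hgauss, div_im_div_neg_one_div_im hτ,
    div_div_eq_mul_div, mul_comm _ τ, mul_div_assoc τ, mul_assoc τ, ← mul_div_assoc (exp _),
    ← exp_add]
  congr 3
  push_cast
  field_simp
  ring

lemma latticeSum_neg_one_div (N : ℝ) (hτ : τ.im ≠ 0) (w z : ℂ) :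
    latticeSum N (-1 / τ) (w / τ) (z / τ) =
      τ * exp (2 * π * I * (w * z / τ)) * latticeSum N τ w z := by
  let rotation : ℤ × ℤ ≃ ℤ × ℤ :=
    (Equiv.prodComm ℤ ℤ).trans ((Equiv.refl ℤ).prodCongr (Equiv.neg ℤ))
  rw [latticeSum, latticeSum, ← rotation.tsum_eq (latticeTerm N τ w z),
    ← tsum_mul_left]
  exact tsum_congr fun p => latticeTerm_neg_one_div N hτ w z p.1 p.2

lemma latticeTerm_nat_mul {M : ℕ} (hM : M ≠ 0) (N : ℝ) (τ w z : ℂ) (r a k : ℤ) :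
    latticeTerm N (M * τ) (M * w) (z + r * τ) (a, k) =
      exp (-(2 * π * I * (r * w))) * latticeTerm (N / M) τ w z (r + M * a, k) := by
  have hM' : (M : ℝ) ≠ 0 := mod_cast hM
  have hMC : (M : ℂ) ≠ 0 := mod_cast hM
  have hpoint : z + r * τ + a * (M * τ) + k = z + (r + M * a : ℤ) * τ + k := by
    push_cast
    ring
  have him (u : ℂ) : ((M : ℂ) * u).im = M * u.im := by
    rw [← ofReal_natCast, im_ofReal_mul]
  have hgauss (Z : ℂ) : π * N / (M * τ.im) * ‖Z‖ ^ 2 = π * (N / M) / τ.im * ‖Z‖ ^ 2 := by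
    field_simp
  rw [latticeTerm, latticeTerm, hpoint, him, him, hgauss, ← mul_div_assoc (exp _), ← exp_add]
  congr 2
  push_cast
  rw [mul_div_mul_left _ _ hMC]
  ring

lemma latticeTerm_div_nat {M : ℕ} (hM : M ≠ 0) (N : ℝ) (τ w z : ℂ) (a k : ℤ) :
    latticeTerm N (τ / M) w (z / M) (a, k) = M * latticeTerm (N / M) τ w z (a, M * k) := by
  have hM' : (M : ℝ) ≠ 0 := mod_cast hM
  have hMC : (M : ℂ) ≠ 0 := mod_cast hM
  have hpoint : z / M + a * (τ / M) + k = (z + a * τ + (M * k : ℤ)) / M := by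
    push_cast
    field_simp
  have him : (τ / M).im = τ.im / M := by
    rw [← ofReal_natCast, div_ofReal_im]
  have hgauss (Z : ℂ) :
      π * N / (τ.im / M) * ‖Z / M‖ ^ 2 = π * (N / M) / τ.im * ‖Z‖ ^ 2 := by
    rw [norm_div, norm_natCast]
    field_simp
  rw [latticeTerm, latticeTerm, hpoint, him, hgauss, div_div_eq_mul_div, mul_comm _ (M : ℂ),
    mul_div_assoc (M : ℂ)]
  congr 4
  push_cast
  field_simp

lemma latticeTerm_add_mul (N : ℝ) (hτ : τ.im ≠ 0) (w z : ℂ) (x : ℝ) (a k : ℤ) :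
    latticeTerm N τ (w + x * τ) z (a, k) =
      exp (-(2 * π * I * (x * (z + k)))) * latticeTerm N τ w z (a, k) := by
  have hτC : (τ.im : ℂ) ≠ 0 := mod_cast hτ
  rw [latticeTerm, latticeTerm, add_im, im_ofReal_mul, ← mul_div_assoc (exp _), ← exp_add]
  congr 2
  push_cast
  field_simp
  ring

end Lattice

/-! ### The completed Appell–Lerch sum -/

section Appell

variable {N : ℕ} {τ : ℂ}

/-- The term of index `a` of the Appell–Lerch sum of degree `N`. -/
def appellTerm (N : ℕ) (τ z₁ z₂ : ℂ) (a : ℤ) : ℂ :=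
  thetaTerm N τ (z₁ + z₂) 0 a / (1 - exp (2 * π * I * (z₁ + a * τ)))

lemma appellTerm_eq (N : ℕ) (τ z₁ z₂ : ℂ) (a : ℤ) :
    appellTerm N τ z₁ z₂ a = exp (2 * π * I * a * N * (z₁ + z₂)) * qpow τ ((a : ℂ) ^ 2 * N) /
      (1 - exp (2 * π * I * z₁) * qpow τ a) := by
  rw [appellTerm, thetaTerm, qpow, qpow, qpow, ← exp_add, ← exp_add, ← exp_add, Int.cast_zero]
  ring_nf

/-- The Appell–Lerch sum of degree `N` with its nonholomorphic completion. Pairing `R_j` with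
`Θ_{-j}` alone makes the correction split along the rows of the lattice, as in
`hasSum_zwegersR_mul_Theta`; the summands with `Θ_j` in `PhiTilde` belong to a second such sum. -/
def completedAppell (N : ℕ) (τ z₁ z₂ : ℂ) : ℂ :=
  ∑' a, appellTerm N τ z₁ z₂ a + 1 / 2 * ∑ j ∈ Finset.range (2 * N),
    zwegersR N j τ ((z₁ - z₂) / 2) * Theta (-(j : ℤ)) N τ (z₁ + z₂)

lemma ofReal_norm_sq (Z : ℂ) : ((‖Z‖ ^ 2 : ℝ) : ℂ) = Z ^ 2 - 2 * I * Z * Z.im := by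
  have hconj : (starRingEnd ℂ) Z = Z - 2 * I * Z.im := by
    have h := sub_conj Z
    push_cast at h
    linear_combination -h
  rw [← normSq_eq_norm_sq, ← mul_conj, hconj]
  ring

lemma thetaTerm_mul_gaussTerm_div (hN : N ≠ 0) (hτ : 0 < τ.im) (z₁ z₂ : ℂ) (a k : ℤ) :
    thetaTerm N τ (z₁ + z₂) 0 a *
        (gaussTerm √(τ.im / N) (2 * N * (((z₁ - z₂) / 2).im / τ.im)) (z₁ + a * τ) k /
          (z₁ + a * τ + k)) =
      latticeTerm N τ (N * z₂) z₁ (a, k) := by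
  have hN' : (N : ℂ) ≠ 0 := mod_cast hN
  have hτ' : (τ.im : ℂ) ≠ 0 := mod_cast hτ.ne'
  have hpoint_im : (z₁ + a * τ + k).im = z₁.im + a * τ.im := by simp
  have hw_im : ((N : ℂ) * z₂).im = N * z₂.im := by simp
  have hv_im : ((z₁ - z₂) / 2).im = (z₁.im - z₂.im) / 2 := by simp
  rw [← mul_div_assoc, latticeTerm]
  congr 1
  rw [thetaTerm, qpow, gaussTerm, ← exp_add, ← exp_add, sq_sqrt_im_div N hτ.le,
    exp_eq_exp_iff_exists_int]
  refine ⟨-(N * a * k), ?_⟩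
  rw [ofReal_mul (π * N / τ.im), ofReal_norm_sq, hpoint_im, hw_im, hv_im]
  push_cast
  field_simp
  ring

lemma hasSum_appellTerm (hN : N ≠ 0) (hτ : 0 < τ.im) {z₁ : ℂ} (hz₁ : OffLattice τ z₁) (z₂ : ℂ) :
    HasSum (appellTerm N τ z₁ z₂)
      (Theta 0 N τ (z₁ + z₂) + I / (2 * π) * latticeSum N τ (N * z₂) z₁ -
        1 / 2 * ∑ j ∈ Finset.range (2 * N),
          zwegersR N j τ ((z₁ - z₂) / 2) * Theta (-(j : ℤ)) N τ (z₁ + z₂)) := by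
  have hN_pos : (0 : ℝ) < N := mod_cast Nat.pos_of_ne_zero hN
  have hΘ : HasSum (thetaTerm N τ (z₁ + z₂) 0) (Theta 0 N τ (z₁ + z₂)) :=
    (summable_thetaTerm hN hτ _ 0).hasSum
  have hlattice : HasSum (fun a : ℤ => ∑' k : ℤ, latticeTerm N τ (N * z₂) z₁ (a, k))
      (latticeSum N τ (N * z₂) z₁) := by
    have h := summable_latticeTerm hN_pos hτ (N * z₂) z₁
    exact h.hasSum.prod_fiberwise fun a => (h.prod_factor a).hasSum
  have herr := hasSum_zwegersR_mul_Theta hN hτ (z₁ + z₂) ((z₁ - z₂) / 2)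
  refine ((hΘ.add (hlattice.mul_left (I / (2 * π)))).sub (herr.mul_left (1 / 2))).congr_fun
    fun a => ?_
  have hrow := inv_one_sub_exp_add_tsum_errTerm (Real.sqrt_pos.2 (div_pos hτ hN_pos))
    (2 * N * (((z₁ - z₂) / 2).im / τ.im)) (hz₁.add_ne_zero a)
  simp only [← thetaTerm_mul_gaussTerm_div hN hτ, tsum_mul_left]
  rw [show (z₁ + z₂) / 2 + (z₁ - z₂) / 2 = z₁ by ring, appellTerm, div_eq_mul_inv]
  linear_combination thetaTerm N τ (z₁ + z₂) 0 a * hrow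

theorem completedAppell_eq (hN : N ≠ 0) (hτ : 0 < τ.im) {z₁ : ℂ} (hz₁ : OffLattice τ z₁)
    (z₂ : ℂ) :
    completedAppell N τ z₁ z₂ =
      Theta 0 N τ (z₁ + z₂) + I / (2 * π) * latticeSum N τ (N * z₂) z₁ := by
  rw [completedAppell, (hasSum_appellTerm hN hτ hz₁ z₂).tsum_eq, sub_add_cancel]

end Appell

section PhiTilde

variable {τ z z₁ z₂ : ℂ}

lemma OffLattice.neg (hz : OffLattice τ z) : OffLattice τ (-z) := fun a b h =>
  hz (-a) (-b) <| by
    push_cast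
    linear_combination -h

lemma PhiTilde_eq_completedAppell (m : ℕ) (hτ : 0 < τ.im) (hz₁ : OffLattice τ z₁)
    (hz₂ : OffLattice τ z₂) (t : ℂ) :
    PhiTilde m τ z₁ z₂ t = exp (2 * π * I * (m + 1) * t) *
      (completedAppell (m + 1) τ z₁ z₂ - completedAppell (m + 1) τ (-z₂) (-z₁)) := by
  have hPhi : Phi m τ z₁ z₂ t = exp (2 * π * I * (m + 1) * t) *
      (∑' a, appellTerm (m + 1) τ z₁ z₂ a - ∑' a, appellTerm (m + 1) τ (-z₂) (-z₁) a) := by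
    rw [Phi, ← (hasSum_appellTerm m.succ_ne_zero hτ hz₁ z₂).summable.tsum_sub
      (hasSum_appellTerm m.succ_ne_zero hτ hz₂.neg (-z₁)).summable]
    congr 1
    refine tsum_congr fun a => ?_
    rw [appellTerm_eq, appellTerm_eq]
    push_cast
    ring_nf
  have hv : (-z₂ - -z₁) / 2 = (z₁ - z₂) / 2 := by ring
  have hu : -z₂ + -z₁ = -(z₁ + z₂) := by ring
  rw [PhiTilde, PhiAdd, hPhi, completedAppell, completedAppell, hv, hu]
  simp only [Theta_neg_neg, mul_sub, Finset.sum_sub_distrib]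
  ring_nf

theorem PhiTilde_eq_latticeSum (m : ℕ) (hτ : 0 < τ.im) (hz₁ : OffLattice τ z₁)
    (hz₂ : OffLattice τ z₂) (t : ℂ) :
    PhiTilde m τ z₁ z₂ t = exp (2 * π * I * (m + 1) * t) * (I / (2 * π)) *
      (latticeSum (m + 1 : ℕ) τ ((m + 1) * z₂) z₁ +
        latticeSum (m + 1 : ℕ) τ ((m + 1) * z₁) z₂) := by
  have hΘ : Theta 0 (m + 1) τ (-z₂ + -z₁) = Theta 0 (m + 1) τ (z₁ + z₂) := by
    rw [← Theta_neg_neg 0 (m + 1) τ (z₁ + z₂), neg_zero]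
    ring_nf
  rw [PhiTilde_eq_completedAppell m hτ hz₁ hz₂, completedAppell_eq m.succ_ne_zero hτ hz₁,
    completedAppell_eq m.succ_ne_zero hτ hz₂.neg, hΘ, mul_neg, latticeSum_neg_neg]
  push_cast
  ring

end PhiTilde

/-! ### Averaging over `M`-torsion translates -/

section Torsion

variable {M : ℕ} [NeZero M]

lemma sum_tsum_residue {β E : Type*} [AddCommGroup E] [UniformSpace E] [IsUniformAddGroup E]
    [CompleteSpace E] [T0Space E] {f : ℤ × β → E} (hf : Summable f) {r : ZMod M → ℤ}
    (hr : ∀ j, (r j : ZMod M) = j) :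
    ∑ j, ∑' p : ℤ × β, f (r j + M * p.1, p.2) = ∑' p, f p := by
  let e : ZMod M × (ℤ × β) → ℤ × β := fun q => (r q.1 + M * q.2.1, q.2.2)
  have he_inj : Function.Injective e := by
    rintro ⟨j, a, b⟩ ⟨j', a', b'⟩ h
    obtain ⟨ha : r j + M * a = r j' + M * a', rfl : b = b'⟩ := Prod.mk.inj h
    obtain rfl : j = j' := by simpa [hr] using congrArg (Int.cast : ℤ → ZMod M) ha
    rw [mul_left_cancel₀ (mod_cast NeZero.ne M) (add_left_cancel ha)]
  have he_surj : Function.Surjective e := by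
    rintro ⟨A, b⟩
    obtain ⟨a, ha⟩ := (ZMod.intCast_eq_intCast_iff_dvd_sub (r A) A M).1 (hr A)
    exact ⟨(A, a, b), Prod.ext (by simp only [e, ← ha, add_sub_cancel]) rfl⟩
  have hs : Summable fun q => f (e q) := hf.comp_injective he_inj
  rw [← (Equiv.ofBijective e ⟨he_inj, he_surj⟩).tsum_eq f]
  exact ((hs.tsum_prod).trans (tsum_fintype _)).symm

lemma tsum_ite_dvd {α E : Type*} [AddCommMonoid E] [TopologicalSpace E] (f : α × ℤ → E) :
    ∑' p : α × ℤ, (if (M : ℤ) ∣ p.2 then f p else 0) = ∑' p : α × ℤ, f (p.1, M * p.2) := by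
  have hinj : Function.Injective fun p : α × ℤ => (p.1, (M : ℤ) * p.2) :=
    Function.injective_id.prodMap (mul_right_injective₀ (mod_cast NeZero.ne M))
  rw [← hinj.tsum_eq]
  · exact tsum_congr fun p => if_pos (dvd_mul_right _ _)
  · rintro ⟨a, k⟩ h
    obtain ⟨b, rfl⟩ : (M : ℤ) ∣ k := by
      by_contra hk
      exact h (if_neg hk)
    exact ⟨(a, b), rfl⟩

lemma sum_stdAddChar_mul {n : ℤ} (hn : IsCoprime n M) (k : ℤ) :
    ∑ x : ZMod M, ZMod.stdAddChar (x * ((n * k : ℤ) : ZMod M)) =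
      if (M : ℤ) ∣ k then (M : ℂ) else 0 := by
  have hiff : ((n * k : ℤ) : ZMod M) = 0 ↔ (M : ℤ) ∣ k := by
    rw [ZMod.intCast_zmod_eq_zero_iff_dvd]
    exact ⟨hn.symm.dvd_of_dvd_mul_left, fun h => h.mul_left n⟩
  rw [AddChar.sum_mulShift _ (ZMod.isPrimitive_stdAddChar M), ZMod.card, Nat.cast_ite,
    Nat.cast_zero]
  exact if_congr hiff rfl rfl

theorem sum_sum_tsum_mul_stdAddChar {f : ℤ × ℤ → ℂ} (hf : Summable f) {n : ℤ}
    (hn : IsCoprime n M) {r s : ZMod M → ZMod M → ℤ} (hr : ∀ j k, (r j k : ZMod M) = j)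
    (hs : ∀ j k, (s j k : ZMod M) = k) :
    ∑ j, ∑ k, ∑' p : ℤ × ℤ,
        ZMod.stdAddChar ((s j k : ZMod M) * ((n * p.2 : ℤ) : ZMod M)) * f (r j k + M * p.1, p.2) =
      ∑' p : ℤ × ℤ, M * f (p.1, M * p.2) := by
  have hsum (x : ZMod M) :
      Summable fun p : ℤ × ℤ => ZMod.stdAddChar (x * ((n * p.2 : ℤ) : ZMod M)) * f p :=
    .of_norm_bounded hf.norm fun p => by rw [norm_mul, AddChar.norm_apply, one_mul]
  have hresidue (k : ZMod M) :
      ∑ j, ∑' p : ℤ × ℤ,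
          ZMod.stdAddChar (k * ((n * p.2 : ℤ) : ZMod M)) * f (r j k + M * p.1, p.2) =
        ∑' p : ℤ × ℤ, ZMod.stdAddChar (k * ((n * p.2 : ℤ) : ZMod M)) * f p :=
    sum_tsum_residue (hsum k) fun j => hr j k
  simp only [hs]
  rw [Finset.sum_comm]
  simp only [hresidue]
  rw [← Summable.tsum_finsetSum fun k _ => hsum k, ← tsum_ite_dvd (M := M) fun p => M * f p]
  refine tsum_congr fun p => ?_
  rw [← Finset.sum_mul, sum_stdAddChar_mul hn, ite_mul, zero_mul]

lemma latticeTerm_twist (N : ℕ) {τ : ℂ} (hτ : τ.im ≠ 0) (z₁ z₂ : ℂ) (r s a k : ℤ) :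
    qpow τ (N / M * r * s) * exp (2 * π * I * N / M * (s * z₁ + r * z₂)) *
        latticeTerm N (M * τ) (N * (z₂ + s * τ)) (z₁ + r * τ) (a, k) =
      ZMod.stdAddChar ((s : ZMod M) * ((-N * k : ℤ) : ZMod M)) *
        latticeTerm (N / M) τ (N * (z₂ / M)) z₁ (r + M * a, k) := by
  have hM : (M : ℂ) ≠ 0 := mod_cast NeZero.ne M
  have hw : (N * (z₂ + s * τ) : ℂ) =
      M * (N * (z₂ / M) + ((N * s / M : ℝ) : ℂ) * τ) := by
    push_cast
    field_simp
  rw [hw, latticeTerm_nat_mul (NeZero.ne M), latticeTerm_add_mul _ hτ, ← Int.cast_mul,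
    ZMod.stdAddChar_coe, qpow, ← mul_assoc, ← mul_assoc, ← exp_add, ← exp_add, ← exp_add]
  congr 2
  push_cast
  field_simp
  ring

theorem sum_twist_mul_latticeSum {N : ℕ} (hN : N ≠ 0) (hNM : N.Coprime M) {τ : ℂ}
    (hτ : 0 < τ.im) (z₁ z₂ : ℂ) {r s : ZMod M → ZMod M → ℤ}
    (hr : ∀ j k, (r j k : ZMod M) = j) (hs : ∀ j k, (s j k : ZMod M) = k) :
    ∑ j, ∑ k, qpow τ (N / M * r j k * s j k) *
        exp (2 * π * I * N / M * (s j k * z₁ + r j k * z₂)) *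
        latticeSum N (M * τ) (N * (z₂ + s j k * τ)) (z₁ + r j k * τ) =
      latticeSum N (τ / M) (N * (z₂ / M)) (z₁ / M) := by
  have hNM_pos : (0 : ℝ) < N / M :=
    div_pos (mod_cast Nat.pos_of_ne_zero hN) (mod_cast NeZero.pos M)
  have horth := sum_sum_tsum_mul_stdAddChar (summable_latticeTerm hNM_pos hτ (N * (z₂ / M)) z₁)
    (Nat.isCoprime_iff_coprime.2 hNM).neg_left hr hs
  simp only [latticeSum, ← tsum_mul_left, latticeTerm_twist N hτ.ne', horth,
    ← latticeTerm_div_nat (NeZero.ne M)]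

end Torsion

section Transformations

variable {τ z z₁ z₂ : ℂ}

lemma OffLattice.neg_one_div (hτ : τ ≠ 0) (hz : OffLattice τ z) : OffLattice (-1 / τ) (z / τ) :=
  fun a b h => hz (-b) a <| by
    field_simp at h
    push_cast
    linear_combination h

lemma OffLattice.div_nat {M : ℕ} (hM : M ≠ 0) (hz : OffLattice τ z) :
    OffLattice (τ / M) (z / M) := fun a b h => hz (M * a) b <| by
  have hMC : (M : ℂ) ≠ 0 := mod_cast hM
  field_simp at h
  push_cast
  linear_combination h

lemma OffLattice.add_mul (hz : OffLattice τ z) (M : ℕ) (j : ℤ) :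
    OffLattice (M * τ) (z + j * τ) := fun a b h => hz a (b * M - j) <| by
  push_cast
  linear_combination h

theorem PhiTilde_neg_one_div (m : ℕ) (hτ : 0 < τ.im) (hz₁ : OffLattice τ z₁)
    (hz₂ : OffLattice τ z₂) (t : ℂ) :
    PhiTilde m (-1 / τ) (z₁ / τ) (z₂ / τ) (t - z₁ * z₂ / τ) = τ * PhiTilde m τ z₁ z₂ t := by
  have hτ_ne : τ ≠ 0 := fun h => hτ.ne' (by rw [h, zero_im])
  have him : 0 < (-1 / τ).im := by
    rw [neg_one_div_im]
    exact div_pos hτ (normSq_pos.2 hτ_ne)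
  have hphase : exp (2 * π * I * (m + 1) * (t - z₁ * z₂ / τ)) *
      exp (2 * π * I * ((m + 1) * z₂ * z₁ / τ)) = exp (2 * π * I * (m + 1) * t) := by
    rw [← exp_add]
    ring_nf
  rw [PhiTilde_eq_latticeSum m him (hz₁.neg_one_div hτ_ne) (hz₂.neg_one_div hτ_ne),
    PhiTilde_eq_latticeSum m hτ hz₁ hz₂, ← mul_div_assoc _ z₁, ← mul_div_assoc _ z₂,
    latticeSum_neg_one_div _ hτ.ne', latticeSum_neg_one_div _ hτ.ne', mul_right_comm _ z₁ z₂,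
    ← hphase]
  ring

lemma modSummand_eq (M m : ℕ) [NeZero M] (hτ : 0 < τ.im) (hz₁ : OffLattice τ z₁)
    (hz₂ : OffLattice τ z₂) (t : ℂ) (r s : ℤ) :
    modSummand M m τ z₁ z₂ t r s = exp (2 * π * I * (m + 1) * t) * (I / (2 * π)) *
      (qpow τ ((m + 1 : ℕ) / M * r * s) *
          exp (2 * π * I * (m + 1 : ℕ) / M * (s * z₁ + r * z₂)) *
          latticeSum (m + 1 : ℕ) (M * τ) ((m + 1 : ℕ) * (z₂ + s * τ)) (z₁ + r * τ) +
        qpow τ ((m + 1 : ℕ) / M * s * r) *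
          exp (2 * π * I * (m + 1 : ℕ) / M * (r * z₂ + s * z₁)) *
          latticeSum (m + 1 : ℕ) (M * τ) ((m + 1 : ℕ) * (z₁ + r * τ)) (z₂ + s * τ)) := by
  have him : 0 < (M * τ : ℂ).im := by
    rw [← ofReal_natCast, im_ofReal_mul]
    exact mul_pos (mod_cast NeZero.pos M) hτ
  rw [modSummand, PhiTilde_eq_latticeSum m him (hz₁.add_mul M r) (hz₂.add_mul M s),
    mul_right_comm _ (s : ℂ) (r : ℂ), add_comm (r * z₂ : ℂ)]
  push_cast
  ring

theorem PhiTilde_div (M m : ℕ) [NeZero M] (hmM : (m + 1).Coprime M) (hτ : 0 < τ.im)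
    (hz₁ : OffLattice τ z₁) (hz₂ : OffLattice τ z₂) (t : ℂ) {r s : ZMod M → ZMod M → ℤ}
    (hr : ∀ j k, (r j k : ZMod M) = j) (hs : ∀ j k, (s j k : ZMod M) = k) :
    PhiTilde m (τ / M) (z₁ / M) (z₂ / M) t =
      ∑ j, ∑ k, modSummand M m τ z₁ z₂ t (r j k) (s j k) := by
  have him : 0 < (τ / M).im := by
    rw [← ofReal_natCast, div_ofReal_im]
    exact div_pos hτ (mod_cast NeZero.pos M)
  have hsum := sum_twist_mul_latticeSum m.succ_ne_zero hmM hτ z₁ z₂ hr hs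
  have hsum_swap := sum_twist_mul_latticeSum m.succ_ne_zero hmM hτ z₂ z₁
    (r := fun k j => s j k) (s := fun k j => r j k) (fun k j => hs j k) (fun k j => hr j k)
  rw [Finset.sum_comm] at hsum_swap
  simp only [modSummand_eq M m hτ hz₁ hz₂, ← Finset.mul_sum, Finset.sum_add_distrib]
  rw [hsum, hsum_swap, PhiTilde_eq_latticeSum m him (hz₁.div_nat (NeZero.ne M))
    (hz₂.div_nat (NeZero.ne M))]
  push_cast
  rfl

end Transformations

end SL21

end

theorem theorem6p5_general (M m : ℕ) [NeZero M] (hmM : (m + 1).Coprime M) {τ z₁ z₂ : ℂ}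
    (t : ℂ) (hτ : 0 < τ.im) (hz₁ : SL21.OffLattice τ z₁) (hz₂ : SL21.OffLattice τ z₂)
    {r s : ZMod M → ZMod M → ℤ} (hr : ∀ j k, (r j k : ZMod M) = j)
    (hs : ∀ j k, (s j k : ZMod M) = k) :
    SL21.PhiTilde m (-M / τ) (z₁ / τ) (z₂ / τ) (t - z₁ * z₂ / (τ * M)) =
        τ / M * ∑ j, ∑ k, SL21.modSummand M m τ z₁ z₂ t (r j k) (s j k) ∧
      SL21.PhiTilde m (τ / M) (z₁ / M) (z₂ / M) t =
        ∑ j, ∑ k, SL21.modSummand M m τ z₁ z₂ t (r j k) (s j k) := by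
  have hM : (M : ℂ) ≠ 0 := mod_cast NeZero.ne M
  have him : 0 < (τ / M).im := by
    rw [← ofReal_natCast, div_ofReal_im]
    exact div_pos hτ (mod_cast NeZero.pos M)
  have hdiv := SL21.PhiTilde_div M m hmM hτ hz₁ hz₂ t hr hs
  have hinv := SL21.PhiTilde_neg_one_div m him (hz₁.div_nat (NeZero.ne M))
    (hz₂.div_nat (NeZero.ne M)) t
  refine ⟨?_, hdiv⟩
  rw [← hdiv, ← hinv]
  congr 1 <;> field_simp

/-- The sum over `j, k ∈ ℤ/Mℤ` is taken over an arbitrary choice of integer representatives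
`(r j k, s j k)` of the pairs `(j, k)`, so that its independence of the choice is part of the
claim. -/
theorem theorem6p5 (M m : ℕ) [NeZero M] (hM : 0 < m → Nat.gcd M (2 * m + 2) = 1)
    (τ z₁ z₂ t : ℂ) (hτ : 0 < τ.im)
    (hz₁ : ∀ a b : ℤ, z₁ ≠ a + b * τ) (hz₂ : ∀ a b : ℤ, z₂ ≠ a + b * τ)
    (r s : ZMod M → ZMod M → ℤ)
    (hr : ∀ j k : ZMod M, ((r j k : ℤ) : ZMod M) = j)
    (hs : ∀ j k : ZMod M, ((s j k : ℤ) : ZMod M) = k) :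
    SL21.PhiTilde m (-M / τ) (z₁ / τ) (z₂ / τ) (t - z₁ * z₂ / (τ * M)) =
        τ / M * ∑ j : ZMod M, ∑ k : ZMod M, SL21.modSummand M m τ z₁ z₂ t (r j k) (s j k) ∧
      SL21.PhiTilde m (τ / M) (z₁ / M) (z₂ / M) t =
        ∑ j : ZMod M, ∑ k : ZMod M, SL21.modSummand M m τ z₁ z₂ t (r j k) (s j k) := by
  refine theorem6p5_general M m ?_ t hτ hz₁ hz₂ hr hs
  rcases m.eq_zero_or_pos with rfl | hm
  exacts [Nat.coprime_one_left M, (Nat.Coprime.coprime_dvd_right ⟨2, by ring⟩ (hM hm)).symm]
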